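/- Let $p$ be an odd prime, let $n_1,\dots,n_s,m,t$ be positive integers, $n=\sum_{j=1}^s n_j$, with $t\mid n_j$ for all $j$, $t\mid m$, $2\mid n-m$ and $n\ge 3m$. Let $V=\mathbb{F}_{p^{n_1}}\times\cdots\times\mathbb{F}_{p^{n_s}}$ with inner product $\langle a,b\rangle=\sum_j \mathrm{Tr}_{p^{n_j}/p}(a_jb_j)$, let $\zeta_p=e^{2\pi i/p}$, $\chi_b(x)=\zeta_p^{\langle b,x\rangle}$, let $\epsilon=\sqrt{(-1)^{(p-1)/2}}$ (so $\epsilon=1$ if $p\equiv1\pmod 4$ and $\epsilon=i$ if $p\equiv 3\pmod 4$), and let $\eta_m$ be the quadratic character of $\mathbb{F}_{p^m}$. For $f:V\to\mathbb{F}_p$ put $W_f(a)=\sum_{x\in V}\zeta_p^{f(x)-\langle a,x\rangle}$. The function $f$ is bent if $|W_f(a)|=p^{n/2}$ for all $a\in V$; its dual $f^*:V\to\mathbb{F}_p$ is then determined by $W_f(a)=\xi_a\,p^{n/2}\zeta_p^{f^*(a)}$ with $\xi_a\in\{\pm1\}$ if $p\equiv1\pmod 4$ or $n$ is even, and $\xi_a\in\{\pm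 i\}$ otherwise; $f$ is weakly regular with sign $\varepsilon_f\in\{\pm1,\pm i\}$ if $\xi_a=\varepsilon_f$ for all $a$. For $F:V\to\mathbb{F}_{p^m}$ and $c\in\mathbb{F}_{p^m}^*$ put $F_c(x)=\mathrm{Tr}_{p^m/p}(cF(x))$; $F$ is vectorial bent if all $F_c$, $c\neq0$, are bent, and it is vectorial dual-bent with vectorial dual $F^*:V\to\mathbb{F}_{p^m}$ if moreover $F^*$ is vectorial bent and $(F_c)^*=(F^*)_{\sigma(c)}$ for all $c\ne0$, for some permutation $\sigma$ of $\mathbb{F}_{p^m}^*$. Let $F:V\to\mathbb{F}_{p^m}$ be a vectorial dual-bent function satisfying Condition II: there are integers $d,l$ with $\gcd(d-1,p^m-1)=1$ and $(l-1)(d-1)\equiv1\pmod{p^m-1}$, and a constant $\upsilon\in\{\pm\epsilon^m\}$, such that some vectorial dual $F^*$ of $F$ satisfies $(F_c)^*=(F^*)_{c^{1-d}}$ for all $c\in\mathbb{F}_{p^m}^*$; $F(0)=0$ and $F(bx)=b^lF(x)$ for all $b\in\mathbb{F}_{p^t}^*$, $x\in V$; and every $F_c$, $c\in\mathbb{F}_{p^m}^*$,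 is weakly regular with sign $\varepsilon_{F_c}=\upsilon\,\eta_m(c)$. Let $D_1=\{x\in V\setminus\{0\}:F(x)=0\}$, $K=|D_1|$, $\mathbf{c}_b=\frac1{\sqrt K}(\chi_b(x))_{x\in D_1}$ for $b\in V$, and $\mathcal{C}_{D_1}=\{\mathbf{c}_b:b\in V\}$. Then $K=p^{n-m}-1$ and $\mathcal{C}_{D_1}$ is a $(p^n,K)$ codebook, that is, a set of $p^n$ distinct unit-norm vectors in $\mathbb{C}^K$, whose maximal cross-correlation amplitude $I_{\max}(\mathcal{C}_{D_1})=\max_{b_1\ne b_2}|\mathbf{c}_{b_1}\mathbf{c}_{b_2}^H|$ is $$I_{\max}(\mathcal{C}_{D_1})=\max\left\{\tfrac1K|A-1|,\ \tfrac1K|A+1|\right\},\qquad A=\tfrac{1}{p^m}\,\upsilon\, p^{n/2}(-1)^{m-1}\epsilon^m\sqrt{p^m}.$$ For $b_1\neq b_2$ in $V$ the magnitude $|\mathbf{c}_{b_1}\mathbf{c}_{b_2}^H|$ takes only the values $\frac1K$, $\frac1K|A-1|$, $\frac1K|A+1|$, and among the ordered pairs $(b_1,b_2)$ with $b_1\ne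 b_2$ these occur, respectively, $$p^{2n-m}-p^n,\qquad p^n\,\frac{(p^{n-m}+B)(p^m-1)}{2},\qquad p^n\,\frac{(p^{n-m}-B)(p^m-1)}{2}$$ times, where $B=(-1)^{m-1}\epsilon^m\upsilon^{-1}\eta_m(-1)p^{(n-m)/2}$. Moreover, these codebooks are asymptotically optimal with respect to the Welch bound $I_W=\sqrt{\frac{N-K}{K(N-1)}}$, $N=p^n$: as $p\to\infty$ or $m\to\infty$, $I_{\max}(\mathcal{C}_{D_1})/I_W\to1$, uniformly over all data satisfying the above; that is, for every $\delta>0$ there is $M$ such that $|I_{\max}(\mathcal{C}_{D_1})/I_W-1|<\delta$ whenever $p\ge M$ or $m\ge M$. -/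

import Mathlib

open scoped BigOperators

noncomputable section

namespace DualBent

/-- A chosen enumeration of the finite field `GaloisField p n`. -/
instance instFintypeGaloisField (p : ℕ) [Fact p.Prime] (n : ℕ) : Fintype (GaloisField p n) :=
  Fintype.ofFinite _

/-- The space `𝔽_{p^{n₁}} × ⋯ × 𝔽_{p^{nₛ}}`, where `e j` is the exponent `n_j`. -/
abbrev Space (p : ℕ) [Fact p.Prime] {s : ℕ} (e : Fin s → ℕ) : Type :=
  ∀ j : Fin s, GaloisField p (e j)

/-- The absolute trace of `𝔽_{p^n}`. -/
def tr (p : ℕ) [Fact p.Prime] (n : ℕ) (x : GaloisField p n) : ZMod p :=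
  Algebra.trace (ZMod p) (GaloisField p n) x

/-- `ζ_p ^ k` for `k` in `ℤ/pℤ`, where `ζ_p = exp (2πi / p)`. -/
def zetaPow (p : ℕ) [Fact p.Prime] (k : ZMod p) : ℂ := ZMod.stdAddChar k

/-- `p ^ (n / 2)`, the exponent being the rational number `n / 2`. -/
def halfPow (p n : ℕ) : ℝ := (p : ℝ) ^ ((n : ℝ) / 2)

/-- `ε = √((-1) ^ ((p - 1) / 2))`, with the principal square root:
`1` if `p ≡ 1 (mod 4)` and `i` if `p ≡ 3 (mod 4)`. -/
def epsilon (p : ℕ) : ℂ := ((-1 : ℂ) ^ ((p - 1) / 2)) ^ (1 / 2 : ℂ)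

open Classical in
/-- The quadratic multiplicative character of `𝔽_{p^m}`, with value `0` at `0`. -/
def eta (p : ℕ) [Fact p.Prime] (m : ℕ) (c : GaloisField p m) : ℂ :=
  (quadraticChar (GaloisField p m) c : ℂ)

section Bent

variable {p : ℕ} [Fact p.Prime] {s : ℕ} {e : Fin s → ℕ}

/-- The inner product `∑ j, Tr (a_j b_j)`. -/
def ip (a b : Space p e) : ZMod p := ∑ j, tr p (e j) (a j * b j)

/-- The additive character `χ_b (x) = ζ_p ^ ⟨b, x⟩`. -/
def chi (b x : Space p e) : ℂ := zetaPow p (ip b x)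

/-- The Walsh transform of a `p`-ary function. -/
def walsh (f : Space p e → ZMod p) (a : Space p e) : ℂ :=
  ∑ x : Space p e, zetaPow p (f x - ip a x)

/-- `f` is bent: `|W_f (a)| = p ^ (n / 2)` for all `a`, where `n = ∑ j, n_j`. -/
def IsBent (f : Space p e → ZMod p) : Prop :=
  ∀ a, ‖walsh f a‖ = halfPow p (∑ j, e j)

/-- The possible signs of the Walsh values of a bent function in `n` variables, `p` odd:
`± 1` if `p ≡ 1 (mod 4)` or `n` is even, and `± i` otherwise. -/
def walshSigns (p n : ℕ) : Set ℂ :=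
  {z | if p % 4 = 1 ∨ Even n then z = 1 ∨ z = -1 else z = Complex.I ∨ z = -Complex.I}

/-- `g` is the dual of the bent function `f` (`p` odd; such a `g` is unique). -/
def IsDual (f g : Space p e → ZMod p) : Prop :=
  ∀ a, ∃ ξ ∈ walshSigns p (∑ j, e j),
    walsh f a = ξ * (halfPow p (∑ j, e j) : ℂ) * zetaPow p (g a)

/-- `f` is weakly regular bent and the sign of its Walsh transform is `ξ`. -/
def IsWeaklyRegular (f : Space p e → ZMod p) (ξ : ℂ) : Prop :=
  IsBent f ∧ (ξ = 1 ∨ ξ = -1 ∨ ξ = Complex.I ∨ ξ = -Complex.I) ∧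
    ∃ g, IsDual f g ∧
      ∀ a, walsh f a = ξ * (halfPow p (∑ j, e j) : ℂ) * zetaPow p (g a)

variable {m : ℕ}

/-- The component function `F_c (x) = ⟨c, F x⟩ = Tr (c F(x))`. -/
def component (F : Space p e → GaloisField p m) (c : GaloisField p m) :
    Space p e → ZMod p :=
  fun x => tr p m (c * F x)

/-- All components `F_c` with `c ≠ 0` are bent. -/
def IsVectorialBent (F : Space p e → GaloisField p m) : Prop :=
  ∀ c : (GaloisField p m)ˣ, IsBent (component F (c : GaloisField p m))

/-- `F` is vectorial dual-bent with vectorial dual `G`: both are vectorial bent, and for some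
permutation `σ` of `𝔽_{p^m}^*` the dual of `F_c` is `G_{σ(c)}` for every `c ≠ 0`. -/
def IsVectorialDual (F G : Space p e → GaloisField p m) : Prop :=
  IsVectorialBent F ∧ IsVectorialBent G ∧
    ∃ σ : Equiv.Perm (GaloisField p m)ˣ, ∀ c : (GaloisField p m)ˣ,
      IsDual (component F (c : GaloisField p m)) (component G (σ c : GaloisField p m))

/-- The standing condition on the parameters `n = ∑ n_j`, `m`, `t` (with `e j = n_j`) and on the
vectorial dual-bent function `F`. The inclusions of `𝔽_{p^t}` in the fields `𝔽_{p^{n_j}}` and in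
`𝔽_{p^m}` are the field embeddings `incl j` and `incl'`. -/
structure ConditionII (p : ℕ) [Fact p.Prime] {s : ℕ} (e : Fin s → ℕ) (n m t : ℕ)
    (incl : ∀ j, GaloisField p t →+* GaloisField p (e j))
    (incl' : GaloisField p t →+* GaloisField p m)
    (F : Space p e → GaloisField p m) (d l : ℤ) (υ : ℂ) : Prop where
  p_odd : Odd p
  n_eq : n = ∑ j, e j
  e_pos : ∀ j, 0 < e j
  m_pos : 0 < m
  t_pos : 0 < t
  t_dvd_e : ∀ j, t ∣ e j
  t_dvd_m : t ∣ m
  two_dvd : 2 ∣ n - m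
  three_m_le : 3 * m ≤ n
  gcd_eq : Int.gcd (d - 1) ((p : ℤ) ^ m - 1) = 1
  dual : ∃ Fs : Space p e → GaloisField p m, IsVectorialDual F Fs ∧
    ∀ c : (GaloisField p m)ˣ,
      IsDual (component F (c : GaloisField p m))
        (component Fs ((c ^ (1 - d) : (GaloisField p m)ˣ) : GaloisField p m))
  l_form : ∀ (b : GaloisField p t) (x : Space p e), b ≠ 0 →
    F (fun j => incl j b * x j) = incl' b ^ l * F x
  map_zero : F 0 = 0
  l_d : (l - 1) * (d - 1) ≡ 1 [ZMOD ((p : ℤ) ^ m - 1)]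
  sign_mem : υ = epsilon p ^ m ∨ υ = -epsilon p ^ m
  weakly_regular : ∀ c : (GaloisField p m)ˣ,
    IsWeaklyRegular (component F (c : GaloisField p m)) (υ * eta p m (c : GaloisField p m))

end Bent

section Codebooks

variable {ι : Type*} [Fintype ι]

/-- `|c₁ c₂ᴴ|` for complex row vectors. -/
def crossCorr (c₁ c₂ : EuclideanSpace ℂ ι) : ℝ := ‖inner ℂ c₂ c₁‖

/-- `C` is an `(N, K)` codebook: `N` distinct complex vectors of length `K` and norm one. -/
def IsCodebook (C : Set (EuclideanSpace ℂ ι)) (N K : ℕ) : Prop :=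
  Fintype.card ι = K ∧ C.Finite ∧ C.ncard = N ∧ ∀ c ∈ C, ‖c‖ = 1

/-- The cross-correlation magnitudes of pairs of distinct codewords. -/
def crossCorrSet (C : Set (EuclideanSpace ℂ ι)) : Set ℝ :=
  {r | ∃ c₁ ∈ C, ∃ c₂ ∈ C, c₁ ≠ c₂ ∧ r = crossCorr c₁ c₂}

/-- The maximal cross-correlation amplitude of a codebook. -/
def Imax (C : Set (EuclideanSpace ℂ ι)) : ℝ := sSup (crossCorrSet C)

/-- The Welch bound `√((N - K) / (K (N - 1)))`. -/
def welchBound (N K : ℕ) : ℝ :=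
  Real.sqrt (((N : ℝ) - (K : ℝ)) / ((K : ℝ) * ((N : ℝ) - 1)))

end Codebooks

section Construction

variable {p : ℕ} [Fact p.Prime] {s : ℕ} {e : Fin s → ℕ} {m : ℕ}

open Classical in
/-- `D₁ = {x ≠ 0 : F(x) = 0}`. -/
def D1 (F : Space p e → GaloisField p m) : Finset (Space p e) :=
  Finset.univ.filter fun x => x ≠ 0 ∧ F x = 0

/-- The vector `c_b = (χ_b(x) / √K)_{x ∈ D₁}`, where `K = |D₁|`. -/
def codeword (F : Space p e → GaloisField p m) (b : Space p e) : EuclideanSpace ℂ (D1 F) :=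
  WithLp.toLp 2 fun x => (1 / (Real.sqrt ((D1 F).card : ℝ) : ℂ)) * chi b (x : Space p e)

/-- The set of all vectors `c_b`. -/
def codebook (F : Space p e → GaloisField p m) : Set (EuclideanSpace ℂ (D1 F)) :=
  Set.range (codeword F)

/-- The number of ordered pairs `(b₁, b₂)`, `b₁ ≠ b₂`, with `|c_{b₁} c_{b₂}ᴴ| = r`. -/
def multiplicity (F : Space p e → GaloisField p m) (r : ℝ) : ℕ :=
  Set.ncard {b : Space p e × Space p e |
    b.1 ≠ b.2 ∧ crossCorr (codeword F b.1) (codeword F b.2) = r}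

/-- The number `(1 / p^m) υ p^{n/2} (-1)^{m-1} ε^m √(p^m)`. -/
def mainTerm (p n m : ℕ) (υ : ℂ) : ℂ :=
  (1 / (p : ℂ) ^ m) * υ * (halfPow p n : ℂ) * (-1) ^ (m - 1) * epsilon p ^ m *
    (Real.sqrt ((p : ℝ) ^ m) : ℂ)

/-- The number `(-1)^{m-1} ε^m υ⁻¹ η_m(-1) p^{(n-m)/2}`; here `n - m` is even and nonnegative. -/
def freqTerm (p : ℕ) [Fact p.Prime] (n m : ℕ) (υ : ℂ) : ℂ :=
  (-1) ^ (m - 1) * epsilon p ^ m * υ⁻¹ * eta p m (-1) * (p : ℂ) ^ ((n - m) / 2)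

end Construction

end DualBent

end

/-! Write n = m + 2k and S(b) = ∑ χ_b(x) over x in D₁. The cross-correlation of c_{b₁} and c_{b₂} is
|S(b₁ - b₂)| / K, so everything rests on the values of S and how often they occur.

Detecting F(x) = 0 by the additive characters of 𝔽_{p^m} turns p^m (1 + S(b)) into the sum over c of
the Walsh values W_{F_c}(-b). The term c = 0 contributes only at b = 0. By weak regularity and the
form of the duals, the others are υ η_m(c) p^{n/2} ζ_p^{Tr(c^{1-d} F*(-b))}. Since 1 - d is odd and
invertible modulo p^m - 1, the map c ↦ c^{1-d} permutes the units and preserves η_m; what remains is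
υ p^{n/2} G η_m(F*(-b)) with G the quadratic Gauss sum (`ConditionII.exists_sum_zeros`).

The sign of G is never evaluated. Squaring shows that υ p^{n/2} G = ±p^{m+k} and A = ±p^k, so S(b) =
A g(b) - 1 for b ≠ 0, with g valued in {0, 1, -1}. A parity argument settles b = 0: F is even, so
|D₁| is even, which forces η_m(F*(0)) = 0 and K = p^{2k} - 1. The moments ∑ S = 0 and ∑ |S|² = p^n K
then determine ∑ g and ∑ g², hence how often each value is taken
(`ConditionII.exists_distribution`).

Finally I_max = (p^k + 1) / K, and n ≥ 3m gives p^k ≥ p^m, so the ratio to the Welch bound is 1 +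
O(p^{-m}) with an absolute constant. -/

namespace DualBent

/-! ### Additive and quadratic characters of 𝔽_{p^m}, and the square of the Gauss sum. -/

section Characters

variable (p : ℕ) [Fact p.Prime]

lemma zetaPow_add (a b : ZMod p) : zetaPow p (a + b) = zetaPow p a * zetaPow p b :=
  AddChar.map_add_eq_mul _ _ _

lemma zetaPow_zero : zetaPow p 0 = 1 := AddChar.map_zero_eq_one _

lemma zetaPow_neg (a : ZMod p) : zetaPow p (-a) = (starRingEnd ℂ) (zetaPow p a) :=
  AddChar.map_neg_eq_conj _ _

lemma zetaPow_injective : Function.Injective (zetaPow p) := ZMod.injective_stdAddChar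

/-- The canonical additive character of `𝔽_{p^m}`. -/
noncomputable def trChar (m : ℕ) : AddChar (GaloisField p m) ℂ :=
  (ZMod.stdAddChar (N := p)).compAddMonoidHom
    (Algebra.trace (ZMod p) (GaloisField p m)).toAddMonoidHom

lemma trChar_apply (m : ℕ) (x : GaloisField p m) : trChar p m x = zetaPow p (tr p m x) := rfl

lemma trChar_isPrimitive (m : ℕ) : (trChar p m).IsPrimitive := by
  apply AddChar.IsPrimitive.of_ne_one
  intro h
  obtain ⟨x, hx⟩ := Algebra.trace_surjective (ZMod p) (GaloisField p m) 1
  have h1 : zetaPow p (tr p m x) = 1 := by rw [← trChar_apply, h]; rfl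
  rw [← zetaPow_zero p] at h1
  have h2 := zetaPow_injective p h1
  rw [tr, hx] at h2
  exact one_ne_zero h2

lemma tr_add (m : ℕ) (x y : GaloisField p m) : tr p m (x + y) = tr p m x + tr p m y :=
  map_add _ _ _

lemma tr_neg (m : ℕ) (x : GaloisField p m) : tr p m (-x) = -tr p m x := map_neg _ _

lemma tr_zero (m : ℕ) : tr p m 0 = 0 := map_zero _

lemma card_galoisField {m : ℕ} (hm : 0 < m) : Fintype.card (GaloisField p m) = p ^ m := by
  rw [← Nat.card_eq_fintype_card, GaloisField.card p m hm.ne']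

open Classical in
lemma sum_zetaPow_tr_mul {m : ℕ} (hm : 0 < m) (y : GaloisField p m) :
    ∑ c, zetaPow p (tr p m (c * y)) = if y = 0 then (p : ℂ) ^ m else 0 := by
  have h := AddChar.sum_mulShift y (trChar_isPrimitive p m)
  simp only [trChar_apply, card_galoisField p hm] at h
  rw [h]
  push_cast
  rfl

/-- The quadratic character of `𝔽_{p^m}` with complex values. -/
noncomputable def quadChar (m : ℕ) : MulChar (GaloisField p m) ℂ :=
  open Classical in (quadraticChar (GaloisField p m)).ringHomComp (Int.castRingHom ℂ)

lemma quadChar_apply (m : ℕ) (c : GaloisField p m) : quadChar p m c = eta p m c := rfl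

/-- The quadratic Gauss sum of `𝔽_{p^m}`. -/
noncomputable def quadGauss (m : ℕ) : ℂ := gaussSum (quadChar p m) (trChar p m)

variable {p}

lemma ringChar_galoisField_ne_two (hp : Odd p) (m : ℕ) : ringChar (GaloisField p m) ≠ 2 := by
  rw [ringChar.eq (GaloisField p m) p]
  rintro rfl
  exact absurd hp (by decide)

lemma quadChar_ne_one (hp : Odd p) (m : ℕ) : quadChar p m ≠ 1 := by
  classical
  exact (MulChar.ringHomComp_ne_one_iff (Int.castRingHom ℂ).injective_int).mpr
    (quadraticChar_ne_one (ringChar_galoisField_ne_two hp m))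

lemma quadGauss_sq (hp : Odd p) {m : ℕ} (hm : 0 < m) :
    quadGauss p m ^ 2 = eta p m (-1) * (p : ℂ) ^ m := by
  classical
  have hq : (quadChar p m).IsQuadratic := (quadraticChar_isQuadratic _).comp _
  rw [quadGauss, gaussSum_sq (quadChar_ne_one hp m) hq (trChar_isPrimitive p m),
    card_galoisField p hm, quadChar_apply]
  push_cast
  rfl

lemma eta_zero (m : ℕ) : eta p m 0 = 0 := by
  simp [eta]

/-- For y ≠ 0, rescaling c by y pulls out η_m(y); at y = 0 both sides vanish because η_m is
nontrivial. -/
lemma sum_eta_mul_zetaPow (hp : Odd p) {m : ℕ} (y : GaloisField p m) :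
    ∑ c, eta p m c * zetaPow p (tr p m (c * y)) = quadGauss p m * eta p m y := by
  classical
  by_cases hy : y = 0
  · subst hy
    simp only [mul_zero, tr_zero, zetaPow_zero, mul_one, eta_zero]
    exact MulChar.sum_eq_zero_of_ne_one (quadChar_ne_one hp m)
  · have h := gaussSum_mulShift (quadChar p m) (trChar p m) (Units.mk0 y hy)
    have h2 : eta p m y * eta p m y = 1 := by
      have := quadraticChar_sq_one hy
      rw [eta, ← Int.cast_mul, ← sq, this, Int.cast_one]
    have h3 : ∑ c, eta p m c * zetaPow p (tr p m (c * y)) =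
        gaussSum (quadChar p m) ((trChar p m).mulShift (Units.mk0 y hy : (GaloisField p m)ˣ)) := by
      refine Finset.sum_congr rfl fun c _ => ?_
      rw [AddChar.mulShift_apply, trChar_apply, quadChar_apply, mul_comm c y]
      rfl
    rw [h3, quadGauss, ← h]
    simp only [Units.val_mk0, quadChar_apply]
    linear_combination (-(gaussSum (quadChar p m) ((trChar p m).mulShift y))) * h2

lemma epsilon_sq (p : ℕ) : epsilon p ^ 2 = (-1) ^ ((p - 1) / 2) := by
  rw [epsilon, ← Complex.cpow_nat_mul]
  norm_num

lemma epsilon_pow_four (p : ℕ) : epsilon p ^ 4 = 1 := by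
  rw [show 4 = 2 * 2 from rfl, pow_mul, epsilon_sq, ← pow_mul, mul_comm, pow_mul]
  norm_num

lemma eta_neg_one (hp : Odd p) {m : ℕ} (hm : 0 < m) :
    eta p m (-1) = epsilon p ^ (2 * m) := by
  classical
  rw [eta, quadraticChar_neg_one (ringChar_galoisField_ne_two hp m), card_galoisField p hm,
    pow_mul, epsilon_sq]
  push_cast
  rw [map_pow, ZMod.χ₄_eq_neg_one_pow (Nat.odd_iff.mp hp)]
  obtain ⟨k, rfl⟩ := hp
  rw [show (2 * k + 1) / 2 = k by omega, show (2 * k + 1 - 1) / 2 = k by omega]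
  push_cast
  rfl

end Characters

/-! ### The inner product on V and orthogonality of its characters. -/

section Space

variable {p : ℕ} [Fact p.Prime] {s : ℕ} {e : Fin s → ℕ}

lemma ip_add_left (a b x : Space p e) : ip (a + b) x = ip a x + ip b x := by
  simp only [ip, Pi.add_apply, add_mul, tr_add, Finset.sum_add_distrib]

lemma ip_neg_left (b x : Space p e) : ip (-b) x = -ip b x := by
  simp only [ip, Pi.neg_apply, neg_mul, tr_neg, Finset.sum_neg_distrib]

lemma ip_zero_left (x : Space p e) : ip 0 x = 0 := by
  simp [ip, tr_zero]

lemma ip_zero_right (x : Space p e) : ip x 0 = 0 := by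
  simp [ip, tr_zero]

lemma chi_zero_left (x : Space p e) : chi 0 x = 1 := by
  rw [chi, ip_zero_left, zetaPow_zero]

lemma chi_zero_right (x : Space p e) : chi x 0 = 1 := by
  rw [chi, ip_zero_right, zetaPow_zero]

lemma chi_add_left (a b x : Space p e) : chi (a + b) x = chi a x * chi b x := by
  rw [chi, ip_add_left, zetaPow_add]; rfl

lemma chi_neg_left (b x : Space p e) : chi (-b) x = (starRingEnd ℂ) (chi b x) := by
  rw [chi, ip_neg_left, zetaPow_neg]; rfl

lemma ip_comm (a b : Space p e) : ip a b = ip b a := by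
  simp only [ip, mul_comm]

lemma chi_comm (a b : Space p e) : chi a b = chi b a := by
  rw [chi, ip_comm]; rfl

lemma card_space (he : ∀ j, 0 < e j) : Fintype.card (Space p e) = p ^ ∑ j, e j := by
  rw [Fintype.card_pi, ← Finset.prod_pow_eq_pow_sum]
  exact Finset.prod_congr rfl fun j _ => card_galoisField p (he j)

open Classical in
lemma sum_chi (he : ∀ j, 0 < e j) (x : Space p e) :
    ∑ b, chi b x = if x = 0 then (p : ℂ) ^ (∑ j, e j) else 0 := by
  split_ifs with hx
  · subst hx
    simp [chi_zero_right, card_space he]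
  · let ψ : AddChar (Space p e) ℂ :=
      { toFun := fun b => chi b x
        map_zero_eq_one' := chi_zero_left x
        map_add_eq_mul' := fun a b => chi_add_left a b x }
    have hψ : ψ ≠ 0 := by
      intro h
      apply hx
      funext j
      by_contra hj
      -- A character trivial on V is trivial on the j-th coordinate axis, where it is the trace
      -- character scaled by x j ≠ 0.
      apply trChar_isPrimitive p (e j) hj
      ext c
      have h1 : ψ (Pi.single j c) = 1 := by rw [h]; rfl
      have h2 : ψ (Pi.single j c) = zetaPow p (tr p (e j) (x j * c)) := by
        change zetaPow p (ip (Pi.single j c) x) = _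
        rw [ip, Finset.sum_eq_single j]
        · rw [Pi.single_eq_same, mul_comm]
        · intro i _ hi
          rw [Pi.single_eq_of_ne hi, zero_mul, tr_zero]
        · simp
      rw [AddChar.mulShift_apply, trChar_apply, ← h2, h1]
      rfl
    exact AddChar.sum_eq_zero_iff_ne_zero.mpr hψ

end Space

/-! ### Uniqueness of the dual. -/

section DualUnique

variable {p : ℕ} [Fact p.Prime] {s : ℕ} {e : Fin s → ℕ}

lemma halfPow_pos (p : ℕ) [Fact p.Prime] (n : ℕ) : 0 < halfPow p n :=
  Real.rpow_pos_of_pos (by exact_mod_cast (Fact.out : p.Prime).pos) _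

lemma sq_eq_of_mem_walshSigns {p n : ℕ} {ξ ξ' : ℂ} (h : ξ ∈ walshSigns p n)
    (h' : ξ' ∈ walshSigns p n) : ξ ^ 2 = ξ' ^ 2 ∧ ξ ≠ 0 := by
  simp only [walshSigns, Set.mem_ofPred_eq] at h h'
  split_ifs at h h' with hc
  · rcases h with rfl | rfl <;> rcases h' with rfl | rfl <;> norm_num
  · rcases h with rfl | rfl <;> rcases h' with rfl | rfl <;> norm_num

/-- The dual of a `p`-ary bent function is unique. -/
lemma IsDual.unique (hp : Odd p) {f g g' : Space p e → ZMod p} (h : IsDual f g)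
    (h' : IsDual f g') : g = g' := by
  funext a
  obtain ⟨ξ, hξ, hw⟩ := h a
  obtain ⟨ξ', hξ', hw'⟩ := h' a
  obtain ⟨hsq, h0⟩ := sq_eq_of_mem_walshSigns hξ hξ'
  have hH : (halfPow p (∑ j, e j) : ℂ) ≠ 0 :=
    Complex.ofReal_ne_zero.mpr (halfPow_pos p _).ne'
  have h1 : ξ * zetaPow p (g a) = ξ' * zetaPow p (g' a) := by
    apply mul_right_cancel₀ hH
    rw [hw] at hw'
    linear_combination hw'
  -- Squaring removes the unknown signs, as all admissible signs have the same square. The resulting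
  -- factor 2 can be cancelled because p is odd.
  have h2 : zetaPow p (g a + g a) = zetaPow p (g' a + g' a) := by
    apply mul_left_cancel₀ (pow_ne_zero 2 h0)
    rw [zetaPow_add, zetaPow_add]
    linear_combination (ξ * zetaPow p (g a) + ξ' * zetaPow p (g' a)) * h1
      - zetaPow p (g' a) ^ 2 * hsq
  have h3 := zetaPow_injective p h2
  have h4 : (2 : ZMod p) ≠ 0 := by
    intro h
    have h5 : ((2 : ℕ) : ZMod p) = 0 := by exact_mod_cast h
    rw [ZMod.natCast_eq_zero_iff] at h5
    have := (Nat.prime_dvd_prime_iff_eq Fact.out Nat.prime_two).mp h5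
    subst this
    exact absurd hp (by decide)
  apply mul_left_cancel₀ h4
  linear_combination h3

/-- Weak regularity supplies some dual; uniqueness moves its Walsh formula to the dual prescribed by
the vectorial dual. -/
lemma IsWeaklyRegular.walsh_eq (hp : Odd p) {f g : Space p e → ZMod p} {ξ : ℂ}
    (h : IsWeaklyRegular f ξ) (hg : IsDual f g) (a : Space p e) :
    walsh f a = ξ * (halfPow p (∑ j, e j) : ℂ) * zetaPow p (g a) := by
  obtain ⟨-, -, g', hg', hw⟩ := h
  rw [hg.unique hp hg']
  exact hw a

end DualUnique

lemma sum_eq_zero_add_sum_units {K : Type*} [Field K] [Fintype K] [Fintype Kˣ] (f : K → ℂ) :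
    ∑ c, f c = f 0 + ∑ u : Kˣ, f u := by
  classical
  have h : (Finset.univ : Finset K) =
      insert 0 ((Finset.univ : Finset Kˣ).map ⟨Units.val, Units.val_injective⟩) := by
    ext c
    simp only [Finset.mem_univ, Finset.mem_insert, Finset.mem_map, Function.Embedding.coeFn_mk,
      true_and, true_iff]
    by_cases hc : c = 0
    · exact Or.inl hc
    · exact Or.inr ⟨Units.mk0 c hc, rfl⟩
  rw [h, Finset.sum_insert (by simp), Finset.sum_map]
  rfl

/-! ### Character sums over the zero set of F. -/

section CharacterSum

variable {p : ℕ} [Fact p.Prime] {s : ℕ} {e : Fin s → ℕ} {m : ℕ}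

open Classical in
lemma mul_sum_zeros (he : ∀ j, 0 < e j) (hm : 0 < m) (F : Space p e → GaloisField p m)
    (b : Space p e) :
    (p : ℂ) ^ m * ∑ x with F x = 0, chi b x =
      (if b = 0 then (p : ℂ) ^ (∑ j, e j) else 0) +
        ∑ u : (GaloisField p m)ˣ, walsh (component F (u : GaloisField p m)) (-b) := by
  have h0 : ∑ x, chi b x = if b = 0 then (p : ℂ) ^ (∑ j, e j) else 0 := by
    rw [← sum_chi he b]
    exact Finset.sum_congr rfl fun x _ => chi_comm _ _
  have h1 : ∀ c, walsh (component F c) (-b) = ∑ x, chi b x * zetaPow p (tr p m (c * F x)) := by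
    intro c
    refine Finset.sum_congr rfl fun x _ => ?_
    rw [ip_neg_left, sub_neg_eq_add, zetaPow_add, mul_comm]
    rfl
  have h2 : walsh (component F 0) (-b) = if b = 0 then (p : ℂ) ^ (∑ j, e j) else 0 := by
    rw [h1, ← h0]
    simp [tr_zero, zetaPow_zero]
  rw [← h2, ← sum_eq_zero_add_sum_units fun c => walsh (component F c) (-b)]
  simp only [h1]
  rw [Finset.sum_comm, Finset.sum_filter, Finset.mul_sum]
  refine Finset.sum_congr rfl fun x _ => ?_
  rw [← Finset.mul_sum, sum_zetaPow_tr_mul p hm]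
  split_ifs <;> ring

lemma eta_zpow_of_odd (u : (GaloisField p m)ˣ) {k : ℤ} (hk : Odd k) :
    eta p m ((u ^ k : (GaloisField p m)ˣ) : GaloisField p m) =
      eta p m (u : GaloisField p m) := by
  classical
  obtain ⟨j, rfl⟩ := hk
  have h : ∀ v : (GaloisField p m)ˣ,
      eta p m ((v * v : (GaloisField p m)ˣ) : GaloisField p m) = 1 := by
    intro v
    have := quadraticChar_sq_one' v.ne_zero
    rw [Units.val_mul, ← sq, eta, this, Int.cast_one]
  rw [zpow_add, zpow_one, mul_comm 2 j, zpow_mul, zpow_two, Units.val_mul, ← quadChar_apply,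
    map_mul, quadChar_apply, h, one_mul, quadChar_apply]

/-- The unit group has order p^m - 1, so raising to the power j undoes raising to the power k. -/
lemma zpow_bijective_of_modEq (hm : 0 < m) {k j : ℤ} (h : j * k ≡ 1 [ZMOD ((p : ℤ) ^ m - 1)]) :
    Function.Bijective fun u : (GaloisField p m)ˣ => u ^ k := by
  classical
  refine Finite.injective_iff_bijective.mp ?_
  have key : ∀ u : (GaloisField p m)ˣ, (u ^ k) ^ j = u := by
    intro u
    have hc : u ^ ((p : ℤ) ^ m - 1) = 1 := by
      have h1 : Fintype.card (GaloisField p m)ˣ = p ^ m - 1 := by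
        rw [Fintype.card_units, card_galoisField p hm]
      have h2 := pow_card_eq_one (x := u)
      rw [h1] at h2
      have h3 : ((p : ℤ) ^ m - 1) = ((p ^ m - 1 : ℕ) : ℤ) := by
        rw [Nat.cast_sub (Nat.one_le_pow _ _ (Fact.out : p.Prime).pos)]
        push_cast
        ring
      rw [h3, zpow_natCast, h2]
    obtain ⟨r, hr⟩ := h.symm.dvd
    rw [← zpow_mul, show k * j = ((p : ℤ) ^ m - 1) * r + 1 by linear_combination hr, zpow_add,
      zpow_mul, hc, one_zpow, one_mul, zpow_one]
  intro u v huv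
  rw [← key u, ← key v]
  exact congrArg (· ^ j) huv

/-- The modulus p^m - 1 is even. This serves twice: 1 - d is odd, so the power map preserves η_m,
and l - 1 is odd, so F is even. -/
lemma odd_of_mul_modEq {p m : ℕ} (hp : Odd p) {k j : ℤ}
    (h : j * k ≡ 1 [ZMOD ((p : ℤ) ^ m - 1)]) : Odd j ∧ Odd k := by
  rw [← Int.odd_mul]
  obtain ⟨r, hr⟩ := h.symm.dvd
  have h1 : Even ((p : ℤ) ^ m - 1) := by
    have : Odd ((p : ℤ) ^ m) := (Int.odd_coe_nat p).mpr hp |>.pow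
    exact this.sub_odd odd_one
  rw [show j * k = ((p : ℤ) ^ m - 1) * r + 1 by linear_combination hr]
  exact (h1.mul_right r).add_one

variable {n t : ℕ} {incl : ∀ j, GaloisField p t →+* GaloisField p (e j)}
  {incl' : GaloisField p t →+* GaloisField p m} {F : Space p e → GaloisField p m} {d l : ℤ}
  {υ : ℂ}

open Classical in
/-- The character sums over the zero set of a vectorial dual-bent function in terms of its
vectorial dual and the quadratic Gauss sum. -/
lemma ConditionII.exists_sum_zeros (h : ConditionII p e n m t incl incl' F d l υ) :
    ∃ Fs : Space p e → GaloisField p m, ∀ b,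
      (p : ℂ) ^ m * ∑ x with F x = 0, chi b x =
        (if b = 0 then (p : ℂ) ^ n else 0) +
          υ * (halfPow p n : ℂ) * quadGauss p m * eta p m (Fs (-b)) := by
  obtain ⟨Fs, -, hdual⟩ := h.dual
  refine ⟨Fs, fun b => ?_⟩
  rw [mul_sum_zeros h.e_pos h.m_pos, ← h.n_eq]
  congr 1
  have hmod : (1 - l) * (1 - d) ≡ 1 [ZMOD ((p : ℤ) ^ m - 1)] := by
    rw [show (1 - l) * (1 - d) = (l - 1) * (d - 1) by ring]
    exact h.l_d
  have hodd := (odd_of_mul_modEq h.p_odd hmod).2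
  have h1 : ∀ u : (GaloisField p m)ˣ, walsh (component F (u : GaloisField p m)) (-b) =
      υ * (halfPow p n : ℂ) *
        (eta p m ((u ^ (1 - d) : (GaloisField p m)ˣ) : GaloisField p m) *
        zetaPow p (tr p m (((u ^ (1 - d) : (GaloisField p m)ˣ) : GaloisField p m) *
          Fs (-b)))) := by
    intro u
    rw [(h.weakly_regular u).walsh_eq h.p_odd (hdual u), eta_zpow_of_odd u hodd, ← h.n_eq,
      component]
    ring
  simp only [h1]
  rw [← Finset.mul_sum, mul_assoc _ (quadGauss p m), ← sum_eta_mul_zetaPow h.p_odd,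
    sum_eq_zero_add_sum_units fun c => eta p m c * zetaPow p (tr p m (c * Fs (-b))),
    eta_zero, zero_mul, zero_add]
  congr 1
  exact Fintype.sum_bijective _ (zpow_bijective_of_modEq h.m_pos hmod) _ _ fun u => rfl

lemma ConditionII.map_neg (h : ConditionII p e n m t incl incl' F d l υ) (x : Space p e) :
    F (-x) = F x := by
  have hl : Even l := by
    have := (odd_of_mul_modEq h.p_odd h.l_d).1
    simpa using this.add_one
  have h1 := h.l_form (-1) x (neg_ne_zero.mpr one_ne_zero)
  rw [_root_.map_neg, map_one, hl.neg_one_zpow, one_mul] at h1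
  rw [← h1]
  congr 1
  funext j
  rw [_root_.map_neg, map_one, neg_one_mul]
  rfl

lemma ConditionII.two_ne_zero (h : ConditionII p e n m t incl incl' F d l υ) (j : Fin s) :
    (2 : GaloisField p (e j)) ≠ 0 :=
  Ring.two_ne_zero (ringChar_galoisField_ne_two h.p_odd _)

/-- Negation acts on D₁ without fixed points, since F is even and 2 is invertible in every factor of
V. -/
lemma ConditionII.even_card_D1 (h : ConditionII p e n m t incl incl' F d l υ) :
    Even (D1 F).card := by
  classical
  have h1 : ∑ x ∈ D1 F, (1 : ZMod 2) = 0 := by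
    refine Finset.sum_involution (fun x _ => -x) (fun x _ => by decide) ?_ ?_
      (fun x _ => neg_neg x)
    · intro x hx _ hneg
      simp only [D1, Finset.mem_filter, Finset.mem_univ, true_and] at hx
      apply hx.1
      funext j
      have h2 : -x j = x j := congrFun hneg j
      apply mul_left_cancel₀ (h.two_ne_zero j)
      rw [Pi.zero_apply]
      linear_combination -h2
    · intro x hx
      simp only [D1, Finset.mem_filter, Finset.mem_univ, true_and] at hx ⊢
      exact ⟨neg_ne_zero.mpr hx.1, by rw [h.map_neg, hx.2]⟩
  rw [Finset.sum_const, nsmul_eq_mul, mul_one] at h1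
  exact (ZMod.natCast_eq_zero_iff_even).mp h1

lemma ConditionII.exists_half (h : ConditionII p e n m t incl incl' F d l υ) :
    ∃ k, n = m + 2 * k ∧ m ≤ k := by
  have h1 := h.three_m_le
  obtain ⟨k, hk⟩ := h.two_dvd
  exact ⟨k, by omega, by omega⟩

lemma ConditionII.sign_sq (h : ConditionII p e n m t incl incl' F d l υ) :
    υ ^ 2 = epsilon p ^ (2 * m) := by
  rcases h.sign_mem with rfl | rfl <;> ring

lemma epsilon_pow_four_mul (p m : ℕ) : epsilon p ^ (2 * m) * epsilon p ^ (2 * m) = 1 := by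
  rw [← pow_add, show 2 * m + 2 * m = 4 * m by ring, pow_mul, epsilon_pow_four, one_pow]

lemma ConditionII.sign_ne_zero (h : ConditionII p e n m t incl incl' F d l υ) : υ ≠ 0 := by
  intro h0
  have h1 := epsilon_pow_four_mul p m
  rw [← h.sign_sq, h0] at h1
  norm_num at h1

lemma sqrt_pow_sq (p m : ℕ) : (Real.sqrt ((p : ℝ) ^ m) : ℂ) ^ 2 = (p : ℂ) ^ m := by
  rw [← Complex.ofReal_pow, Real.sq_sqrt (by positivity)]
  push_cast
  rfl

lemma halfPow_add_two_mul (p : ℕ) [Fact p.Prime] (m k : ℕ) :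
    (halfPow p (m + 2 * k) : ℂ) = (Real.sqrt ((p : ℝ) ^ m) : ℂ) * (p : ℂ) ^ k := by
  have hp : (0 : ℝ) < p := by exact_mod_cast (Fact.out : p.Prime).pos
  have h1 : halfPow p (m + 2 * k) = Real.sqrt ((p : ℝ) ^ m) * (p : ℝ) ^ k := by
    rw [halfPow, Real.sqrt_eq_rpow, ← Real.rpow_natCast_mul hp.le, ← Real.rpow_natCast,
      ← Real.rpow_add hp]
    congr 1
    push_cast
    ring
  rw [h1]
  push_cast
  rfl

lemma natCast_prime_ne_zero (p : ℕ) [Fact p.Prime] : (p : ℂ) ≠ 0 :=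
  Nat.cast_ne_zero.mpr (Fact.out : p.Prime).ne_zero

lemma mainTerm_eq (p : ℕ) [Fact p.Prime] {n m k : ℕ} (hk : n = m + 2 * k) (υ : ℂ) :
    mainTerm p n m υ = υ * (-1) ^ (m - 1) * epsilon p ^ m * (p : ℂ) ^ k := by
  have hp := pow_ne_zero m (natCast_prime_ne_zero p)
  rw [mainTerm, hk, halfPow_add_two_mul]
  field_simp
  rw [sqrt_pow_sq]
  ring

lemma neg_one_pow_sq (j : ℕ) : ((-1 : ℂ) ^ j) ^ 2 = 1 := by
  rw [← pow_mul, mul_comm, pow_mul, neg_one_sq, one_pow]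

lemma ConditionII.mainTerm_sq (h : ConditionII p e n m t incl incl' F d l υ) {k : ℕ}
    (hk : n = m + 2 * k) : mainTerm p n m υ ^ 2 = ((p : ℂ) ^ k) ^ 2 := by
  rw [mainTerm_eq p hk]
  have h1 := epsilon_pow_four_mul p m
  simp only [mul_pow, neg_one_pow_sq, h.sign_sq, mul_one]
  rw [← pow_mul (epsilon p), mul_comm m 2, h1, one_mul]

/-- Since η_m(-1) = ε^{2m} = υ², the factor υ⁻¹ η_m(-1) is υ, so B = A. -/
lemma ConditionII.freqTerm_eq (h : ConditionII p e n m t incl incl' F d l υ) {k : ℕ}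
    (hk : n = m + 2 * k) : freqTerm p n m υ = mainTerm p n m υ := by
  rw [mainTerm_eq p hk, freqTerm, eta_neg_one h.p_odd h.m_pos, ← h.sign_sq,
    show (n - m) / 2 = k by omega]
  have := h.sign_ne_zero
  field_simp

/-- The character sums over `D₁`, up to a sign, in terms of a function with values in
`{0, 1, -1}`. -/
lemma ConditionII.exists_sum_D1 (h : ConditionII p e n m t incl incl' F d l υ) {k : ℕ}
    (hk : n = m + 2 * k) :
    ∃ (σ : ℤ) (g : Space p e → ℤ), (σ = 1 ∨ σ = -1) ∧ mainTerm p n m υ = σ * (p : ℂ) ^ k ∧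
      (∀ b, g b = 0 ∨ g b = 1 ∨ g b = -1) ∧ g 0 = 0 ∧
      (∑ x ∈ D1 F, chi 0 x = (p : ℂ) ^ (2 * k) - 1) ∧
      ∀ b, b ≠ 0 → ∑ x ∈ D1 F, chi b x = σ * (p : ℂ) ^ k * g b - 1 := by
  classical
  obtain ⟨Fs, hFs⟩ := h.exists_sum_zeros
  have hpm := pow_ne_zero m (natCast_prime_ne_zero p)
  obtain ⟨σ, hσ, hmain⟩ : ∃ σ : ℤ, (σ = 1 ∨ σ = -1) ∧ mainTerm p n m υ = σ * (p : ℂ) ^ k := by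
    rcases sq_eq_sq_iff_eq_or_eq_neg.mp (h.mainTerm_sq hk) with h1 | h1
    · exact ⟨1, Or.inl rfl, by simp [h1]⟩
    · exact ⟨-1, Or.inr rfl, by simp [h1]⟩
  -- Only the square of the Gauss sum is used, so τ stays an unknown sign, unrelated so far to σ.
  obtain ⟨τ, hτ, hgauss⟩ : ∃ τ : ℤ, (τ = 1 ∨ τ = -1) ∧
      υ * (halfPow p n : ℂ) * quadGauss p m = (p : ℂ) ^ m * (τ * (p : ℂ) ^ k) := by
    have h1 : (υ * (halfPow p n : ℂ) * quadGauss p m) ^ 2 = ((p : ℂ) ^ m * (p : ℂ) ^ k) ^ 2 := by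
      rw [hk, halfPow_add_two_mul]
      simp only [mul_pow, sqrt_pow_sq, quadGauss_sq h.p_odd h.m_pos, h.sign_sq,
        eta_neg_one h.p_odd h.m_pos]
      linear_combination ((p : ℂ) ^ m * ((p : ℂ) ^ k) ^ 2 * (p : ℂ) ^ m) *
        epsilon_pow_four_mul p m
    rcases sq_eq_sq_iff_eq_or_eq_neg.mp h1 with h1 | h1
    · exact ⟨1, Or.inl rfl, by rw [h1]; push_cast; ring⟩
    · exact ⟨-1, Or.inr rfl, by rw [h1]; push_cast; ring⟩
  have hD : ∀ b : Space p e, ∑ x with F x = 0, chi b x = 1 + ∑ x ∈ D1 F, chi b x := by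
    intro b
    have : (Finset.univ.filter fun x => F x = 0) = insert 0 (D1 F) := by
      ext x
      simp only [D1, Finset.mem_filter, Finset.mem_univ, true_and, Finset.mem_insert]
      by_cases hx : x = 0
      · simp [hx, h.map_zero]
      · simp [hx]
    rw [this, Finset.sum_insert (by simp [D1]), chi_zero_right]
  have hsum : ∀ b : Space p e, ∑ x ∈ D1 F, chi b x =
      (if b = 0 then (p : ℂ) ^ (2 * k) else 0) + τ * (p : ℂ) ^ k * eta p m (Fs (-b)) - 1 := by
    intro b
    have h1 := hFs b
    rw [hD, hgauss, hk, pow_add] at h1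
    apply mul_left_cancel₀ hpm
    split_ifs at h1 ⊢ <;> linear_combination h1
  have hg : ∀ y : GaloisField p m, quadraticChar _ y = 0 ∨ quadraticChar _ y = 1 ∨
      quadraticChar _ y = -1 := fun y => quadraticChar_isQuadratic _ y
  have hστ : (σ * σ : ℤ) = 1 := by rcases hσ with rfl | rfl <;> rfl
  -- If η_m(F*(0)) were ±1, then |D₁| = p^{2k} ± p^k - 1 would be odd, contradicting
  -- `ConditionII.even_card_D1`.
  have h0 : quadraticChar _ (Fs 0) = 0 := by
    by_contra hne
    have h1 := hsum 0
    simp only [chi_zero_left, Finset.sum_const, nsmul_eq_mul, mul_one, if_true, neg_zero] at h1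
    have h2 : ((D1 F).card : ℤ) = (p : ℤ) ^ (2 * k) + τ * (p : ℤ) ^ k * quadraticChar _ (Fs 0)
        - 1 := by
      rw [eta] at h1
      exact_mod_cast h1
    have h3 : Even ((D1 F).card : ℤ) := (Int.even_coe_nat _).mpr h.even_card_D1
    have hpo : Odd (p : ℤ) := (Int.odd_coe_nat p).mpr h.p_odd
    have h4 : Odd τ := by rcases hτ with rfl | rfl <;> decide
    have h5 : Odd (quadraticChar _ (Fs 0)) := by
      rcases hg (Fs 0) with h6 | h6 | h6
      · exact absurd h6 hne
      · rw [h6]; decide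
      · rw [h6]; decide
    have h6 : Odd ((D1 F).card : ℤ) := by
      rw [h2]
      exact ((hpo.pow).add_odd ((h4.mul hpo.pow).mul h5)).sub_odd odd_one
    exact (Int.not_even_iff_odd.mpr h6) h3
  -- The factor σ τ absorbs the unknown Gauss sign, so that the coefficient of g is A itself.
  refine ⟨σ, fun b => σ * τ * quadraticChar _ (Fs (-b)), hσ, hmain, ?_, ?_, ?_, ?_⟩
  · intro b
    rcases hσ with rfl | rfl <;> rcases hτ with rfl | rfl <;>
      rcases hg (Fs (-b)) with h1 | h1 | h1 <;> simp [h1]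
  · simp [h0]
  · rw [hsum]
    simp [eta, h0]
  · intro b hb
    have h1 : ((σ : ℂ) * σ) = 1 := by exact_mod_cast hστ
    rw [hsum, if_neg hb, eta]
    push_cast
    linear_combination (-((τ : ℂ) * (p : ℂ) ^ k *
      ((quadraticChar (GaloisField p m) (Fs (-b)) : ℤ) : ℂ))) * h1

end CharacterSum

/-! ### First and second moments of the character sums, and counting from moments. -/

section Moments

variable {p : ℕ} [Fact p.Prime] {s : ℕ} {e : Fin s → ℕ}

lemma sum_sum_chi (he : ∀ j, 0 < e j) {D : Finset (Space p e)} (hD : 0 ∉ D) :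
    ∑ b, ∑ x ∈ D, chi b x = 0 := by
  classical
  rw [Finset.sum_comm]
  refine Finset.sum_eq_zero fun x hx => ?_
  rw [sum_chi he, if_neg]
  rintro rfl
  exact hD hx

lemma chi_mul_conj (a b x : Space p e) :
    chi a x * (starRingEnd ℂ) (chi b x) = chi (a - b) x := by
  rw [← chi_neg_left, ← chi_add_left, sub_eq_add_neg]

lemma sum_mul_conj_sum_chi (he : ∀ j, 0 < e j) (D : Finset (Space p e)) :
    ∑ b, (∑ x ∈ D, chi b x) * (starRingEnd ℂ) (∑ x ∈ D, chi b x) =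
      (p : ℂ) ^ (∑ j, e j) * D.card := by
  classical
  have h1 : ∀ b : Space p e, (∑ x ∈ D, chi b x) * (starRingEnd ℂ) (∑ x ∈ D, chi b x) =
      ∑ x ∈ D, ∑ y ∈ D, chi b (x - y) := by
    intro b
    rw [map_sum, Finset.sum_mul_sum]
    refine Finset.sum_congr rfl fun x _ => Finset.sum_congr rfl fun y _ => ?_
    rw [chi_comm b x, chi_comm b y, chi_mul_conj, chi_comm]
  simp only [h1]
  rw [Finset.sum_comm]
  have h2 : ∀ x ∈ D, ∑ b, ∑ y ∈ D, chi b (x - y) = (p : ℂ) ^ (∑ j, e j) := by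
    intro x hx
    rw [Finset.sum_comm]
    simp only [sum_chi he, sub_eq_zero]
    rw [Finset.sum_ite_eq, if_pos hx]
  rw [Finset.sum_congr rfl h2, Finset.sum_const, nsmul_eq_mul, mul_comm]

end Moments

/-- The number of solutions of `g = ±1` for a `{0, 1, -1}`-valued function. -/
lemma two_mul_card_filter_eq {α : Type*} [Fintype α] {g : α → ℤ}
    (hg : ∀ b, g b = 0 ∨ g b = 1 ∨ g b = -1) {τ : ℤ} (hτ : τ = 1 ∨ τ = -1) :
    2 * ((Finset.univ.filter fun b => g b = τ).card : ℤ) = ∑ b, g b ^ 2 + τ * ∑ b, g b := by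
  rw [Finset.card_filter, Finset.mul_sum, ← Finset.sum_add_distrib]
  push_cast
  rw [Finset.mul_sum]
  refine Finset.sum_congr rfl fun b _ => ?_
  rcases hτ with rfl | rfl <;> rcases hg b with h | h | h <;> simp [h]

lemma card_filter_eq_zero {α : Type*} [Fintype α] {g : α → ℤ}
    (hg : ∀ b, g b = 0 ∨ g b = 1 ∨ g b = -1) :
    ((Finset.univ.filter fun b => g b = 0).card : ℤ) = Fintype.card α - ∑ b, g b ^ 2 := by
  rw [Finset.card_filter, ← Finset.card_univ, Finset.card_eq_sum_ones, Nat.cast_sum,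
    Nat.cast_sum, ← Finset.sum_sub_distrib]
  refine Finset.sum_congr rfl fun b _ => ?_
  rcases hg b with h | h | h <;> simp [h]

/-! ### Cross-correlations as character sums, and their distribution. -/

section CrossCorrelation

variable {p : ℕ} [Fact p.Prime] {s : ℕ} {e : Fin s → ℕ} {m : ℕ}

lemma crossCorr_codeword (F : Space p e → GaloisField p m) (b₁ b₂ : Space p e) :
    crossCorr (codeword F b₁) (codeword F b₂) =
      1 / ((D1 F).card : ℝ) * ‖∑ x ∈ D1 F, chi (b₁ - b₂) x‖ := by
  have h1 : inner ℂ (codeword F b₂) (codeword F b₁) =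
      (1 / ((D1 F).card : ℂ)) * ∑ x ∈ D1 F, chi (b₁ - b₂) x := by
    rw [PiLp.inner_apply, ← Finset.sum_coe_sort (D1 F) fun x => chi (b₁ - b₂) x,
      Finset.mul_sum]
    refine Finset.sum_congr rfl fun x _ => ?_
    have h2 : (Real.sqrt ((D1 F).card : ℝ) : ℂ) * (Real.sqrt ((D1 F).card : ℝ) : ℂ) =
        ((D1 F).card : ℂ) := by
      rw [← Complex.ofReal_mul, Real.mul_self_sqrt (Nat.cast_nonneg _), Complex.ofReal_natCast]
    rw [RCLike.inner_apply, ← chi_mul_conj, ← h2]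
    simp only [codeword, map_mul, map_div₀, map_one, Complex.conj_ofReal]
    ring
  rw [crossCorr, h1, norm_mul, norm_div, norm_one, Complex.norm_natCast]

/-- The correlation depends only on b₁ - b₂, and each difference comes from |V| ordered pairs. -/
lemma multiplicity_eq (he : ∀ j, 0 < e j) (F : Space p e → GaloisField p m) (r : ℝ) :
    multiplicity F r = p ^ (∑ j, e j) *
      {b : Space p e | b ≠ 0 ∧
        1 / ((D1 F).card : ℝ) * ‖∑ x ∈ D1 F, chi b x‖ = r}.ncard := by
  let φ : Space p e × Space p e → Space p e × Space p e := fun q => (q.1 + q.2, q.2)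
  have hφ : Function.Injective φ := by
    rintro ⟨a, b⟩ ⟨a', b'⟩ h
    simp only [φ, Prod.mk.injEq] at h
    obtain ⟨h1, rfl⟩ := h
    rw [add_right_cancel h1]
  have h1 : {b : Space p e × Space p e |
      b.1 ≠ b.2 ∧ crossCorr (codeword F b.1) (codeword F b.2) = r} =
      φ '' ({b : Space p e | b ≠ 0 ∧
        1 / ((D1 F).card : ℝ) * ‖∑ x ∈ D1 F, chi b x‖ = r} ×ˢ Set.univ) := by
    ext ⟨b₁, b₂⟩
    simp only [crossCorr_codeword, Set.mem_ofPred_eq, Set.mem_image, Set.mem_prod, Set.mem_univ,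
      and_true, Prod.exists]
    constructor
    · rintro ⟨hne, hr⟩
      exact ⟨b₁ - b₂, b₂, ⟨sub_ne_zero.mpr hne, hr⟩, by simp [φ]⟩
    · rintro ⟨a, b, ⟨hne, hr⟩, hab⟩
      simp only [φ, Prod.mk.injEq] at hab
      obtain ⟨rfl, rfl⟩ := hab
      rw [add_sub_cancel_right]
      exact ⟨by simpa using hne, hr⟩
  rw [multiplicity, h1, Set.ncard_image_of_injective _ hφ, Set.ncard_prod, Set.ncard_univ,
    Nat.card_eq_fintype_card, card_space he, mul_comm]

variable {n t : ℕ} {incl : ∀ j, GaloisField p t →+* GaloisField p (e j)}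
  {incl' : GaloisField p t →+* GaloisField p m} {F : Space p e → GaloisField p m} {d l : ℤ}
  {υ : ℂ}

/-- The character sums over `D₁`, together with the first two moments of the function that
describes them. -/
lemma ConditionII.exists_distribution (h : ConditionII p e n m t incl incl' F d l υ) {k : ℕ}
    (hk : n = m + 2 * k) :
    ∃ (σ : ℤ) (g : Space p e → ℤ), (σ = 1 ∨ σ = -1) ∧ mainTerm p n m υ = σ * (p : ℂ) ^ k ∧
      (∀ b, g b = 0 ∨ g b = 1 ∨ g b = -1) ∧ g 0 = 0 ∧
      (D1 F).card = p ^ (2 * k) - 1 ∧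
      (∀ b, b ≠ 0 → ∑ x ∈ D1 F, chi b x = mainTerm p n m υ * g b - 1) ∧
      ∑ b, g b = σ * (p : ℤ) ^ k * ((p : ℤ) ^ m - 1) ∧
      ∑ b, g b ^ 2 = (p : ℤ) ^ (2 * k) * ((p : ℤ) ^ m - 1) := by
  classical
  obtain ⟨σ, g, hσ, hmain, hg, hg0, hS0, hS⟩ := h.exists_sum_D1 hk
  have hcardC : ((D1 F).card : ℂ) = (p : ℂ) ^ (2 * k) - 1 := by
    rw [← hS0]
    simp [chi_zero_left]
  have hcard : (D1 F).card = p ^ (2 * k) - 1 := by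
    have h1 : (D1 F).card + 1 = p ^ (2 * k) := by
      have : ((D1 F).card : ℂ) + 1 = (p : ℂ) ^ (2 * k) := by rw [hcardC]; ring
      exact_mod_cast this
    omega
  have hSint : ∀ b, ∑ x ∈ D1 F, chi b x =
      (((if b = 0 then (p : ℤ) ^ (2 * k) else 0) + σ * (p : ℤ) ^ k * g b - 1 : ℤ) : ℂ) := by
    intro b
    by_cases hb : b = 0
    · subst hb
      rw [hS0, hg0]
      simp
    · rw [hS b hb, if_neg hb]
      push_cast
      ring
  have hp0 : (p : ℤ) ^ k ≠ 0 := pow_ne_zero _ (by exact_mod_cast (Fact.out : p.Prime).ne_zero)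
  have hσσ : σ * σ = 1 := by rcases hσ with rfl | rfl <;> rfl
  have hV : ∑ _b : Space p e, (1 : ℤ) = (p : ℤ) ^ m * (p : ℤ) ^ (2 * k) := by
    rw [Finset.sum_const, Finset.card_univ, card_space h.e_pos, ← h.n_eq, hk, nsmul_eq_mul,
      mul_one, pow_add]
    push_cast
    rfl
  -- The first moment of S vanishes since 0 ∉ D₁. It pins the sign of ∑ g relative to σ, which
  -- replaces evaluating the Gauss sum.
  have hfirst : ∑ b, g b = σ * (p : ℤ) ^ k * ((p : ℤ) ^ m - 1) := by
    have h1 := sum_sum_chi h.e_pos (D := D1 F) (by simp [D1])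
    simp only [hSint] at h1
    rw [← Int.cast_sum, Int.cast_eq_zero, Finset.sum_sub_distrib, Finset.sum_add_distrib,
      ← Finset.mul_sum, hV, Finset.sum_ite_eq', if_pos (Finset.mem_univ _)] at h1
    apply mul_left_cancel₀ hp0
    rw [pow_mul'] at h1
    linear_combination σ * h1 - (p : ℤ) ^ k * (∑ b, g b) * hσσ
  refine ⟨σ, g, hσ, hmain, hg, hg0, hcard, fun b hb => by rw [hmain, hS b hb], hfirst, ?_⟩
  have h1 := sum_mul_conj_sum_chi h.e_pos (D1 F)
  simp only [hSint, map_intCast, hcardC] at h1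
  rw [← h.n_eq, hk, pow_add] at h1
  have h2 : ∑ b, ((if b = 0 then (p : ℤ) ^ (2 * k) else 0) + σ * (p : ℤ) ^ k * g b - 1) *
      ((if b = 0 then (p : ℤ) ^ (2 * k) else 0) + σ * (p : ℤ) ^ k * g b - 1) =
      (p : ℤ) ^ m * (p : ℤ) ^ (2 * k) * ((p : ℤ) ^ (2 * k) - 1) := by exact_mod_cast h1
  -- The expansion has no cross term between the indicator of b = 0 and g, because g 0 = 0.
  have h3 : ∀ b, ((if b = 0 then (p : ℤ) ^ (2 * k) else 0) + σ * (p : ℤ) ^ k * g b - 1) *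
      ((if b = 0 then (p : ℤ) ^ (2 * k) else 0) + σ * (p : ℤ) ^ k * g b - 1) =
      (if b = 0 then (p : ℤ) ^ (2 * k) * ((p : ℤ) ^ (2 * k) - 2) else 0) +
        (p : ℤ) ^ (2 * k) * g b ^ 2 - 2 * σ * (p : ℤ) ^ k * g b + 1 := by
    intro b
    rw [pow_mul']
    split_ifs with hb
    · subst hb
      rw [hg0]
      ring
    · linear_combination ((p : ℤ) ^ k) ^ 2 * g b ^ 2 * hσσ
  simp only [h3] at h2
  rw [Finset.sum_add_distrib, Finset.sum_sub_distrib, Finset.sum_add_distrib, ← Finset.mul_sum,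
    ← Finset.mul_sum, hV, Finset.sum_ite_eq', if_pos (Finset.mem_univ _), hfirst] at h2
  apply mul_left_cancel₀ (pow_ne_zero 2 hp0)
  rw [pow_mul'] at h2 ⊢
  linear_combination h2 + 2 * ((p : ℤ) ^ k) ^ 2 * ((p : ℤ) ^ m - 1) * hσσ

lemma ConditionII.three_le (h : ConditionII p e n m t incl incl' F d l υ) : 3 ≤ p := by
  have h1 := (Fact.out : p.Prime).two_le
  obtain ⟨j, hj⟩ := h.p_odd
  omega

lemma ConditionII.three_le_pow (h : ConditionII p e n m t incl incl' F d l υ) {j : ℕ}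
    (hj : m ≤ j) : (3 : ℝ) ≤ (p : ℝ) ^ j := by
  have h1 : (3 : ℝ) ≤ p := by exact_mod_cast h.three_le
  have h2 : j ≠ 0 := (h.m_pos.trans_le hj).ne'
  exact h1.trans (le_self_pow₀ (by linarith) h2)

end CrossCorrelation

/-! ### Numerical estimates for |A ± 1| and for the ratio to the Welch bound. -/

lemma norm_sub_one_add_one_of_sign {M : ℂ} {σ : ℤ} {q : ℝ} (hq : 1 ≤ q) (hσ : σ = 1 ∨ σ = -1)
    (hM : M = σ * (q : ℂ)) : (‖M - 1‖ = q - 1 ∧ ‖M + 1‖ = q + 1) ∨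
      (‖M - 1‖ = q + 1 ∧ ‖M + 1‖ = q - 1) := by
  have h1 : ‖(q : ℂ) - 1‖ = q - 1 := by
    rw [← Complex.ofReal_one, ← Complex.ofReal_sub, Complex.norm_real, Real.norm_eq_abs,
      abs_of_nonneg (by linarith)]
  have h2 : ‖(q : ℂ) + 1‖ = q + 1 := by
    rw [← Complex.ofReal_one, ← Complex.ofReal_add, Complex.norm_real, Real.norm_eq_abs,
      abs_of_nonneg (by linarith)]
  rcases hσ with rfl | rfl
  · left
    simp [hM, h1, h2]
  · right
    constructor
    · rw [hM, ← h2, ← norm_neg]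
      congr 1
      push_cast
      ring
    · rw [hM, ← h1, ← norm_neg]
      congr 1
      push_cast
      ring

/-- The quotient of the maximal cross-correlation amplitude by the Welch bound is `1 + O(1/P)`. -/
lemma abs_div_sqrt_sub_one_le {P q : ℝ} (hP : 3 ≤ P) (hq : P ≤ q) :
    |1 / (q ^ 2 - 1) * (q + 1) /
      √((P * q ^ 2 - (q ^ 2 - 1)) / ((q ^ 2 - 1) * (P * q ^ 2 - 1))) - 1| ≤ 12 / P := by
  set x := 1 / (q ^ 2 - 1) * (q + 1) /
    √((P * q ^ 2 - (q ^ 2 - 1)) / ((q ^ 2 - 1) * (P * q ^ 2 - 1))) with hx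
  have hq1 : 0 < q - 1 := by linarith
  have hK : 0 < q ^ 2 - 1 := by nlinarith
  have hPq : 9 ≤ q ^ 2 := by nlinarith
  have hN : 0 < P * q ^ 2 - 1 := by nlinarith
  have hNK : 0 < P * q ^ 2 - (q ^ 2 - 1) := by nlinarith
  have hx0 : 0 ≤ x := by
    have : 0 ≤ 1 / (q ^ 2 - 1) := by rw [one_div]; exact inv_nonneg.mpr hK.le
    rw [hx]
    exact div_nonneg (mul_nonneg this (by linarith)) (Real.sqrt_nonneg _)
  have hx2 : x ^ 2 = (q + 1) * (P * q ^ 2 - 1) / ((q - 1) * (P * q ^ 2 - (q ^ 2 - 1))) := by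
    rw [hx, div_pow, Real.sq_sqrt (by positivity)]
    have : q ^ 2 - 1 = (q - 1) * (q + 1) := by ring
    have hq2 : 0 < q + 1 := by linarith
    rw [div_div_eq_mul_div, mul_pow, div_pow, this]
    rw [this] at hNK
    field_simp
  have h1 : 1 ≤ x ^ 2 := by
    rw [hx2, one_le_div (by positivity)]
    nlinarith
  have hP1 : 0 < P - 1 := by linarith
  have h2 : x ^ 2 ≤ ((P + 1) / (P - 1)) * (P / (P - 1)) := by
    rw [hx2, mul_div_mul_comm]
    -- Here q ≥ P enters, that is, n ≥ 3m.
    have ha : (q + 1) / (q - 1) ≤ (P + 1) / (P - 1) := by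
      rw [div_le_div_iff₀ hq1 hP1]
      linarith
    have hb : (P * q ^ 2 - 1) / (P * q ^ 2 - (q ^ 2 - 1)) ≤ P / (P - 1) := by
      rw [div_le_div_iff₀ hNK hP1]
      linarith
    exact mul_le_mul ha hb (by positivity) (by positivity)
  have h3 : ((P + 1) / (P - 1)) * (P / (P - 1)) - 1 ≤ 12 / P := by
    have : ((P + 1) / (P - 1)) * (P / (P - 1)) - 1 = (3 * P - 1) / (P - 1) ^ 2 := by
      field_simp
      ring
    rw [this, div_le_div_iff₀ (by positivity) (by linarith)]
    nlinarith
  -- From x ≥ 0 and x² ≥ 1 follows x ≥ 1, so 0 ≤ x - 1 ≤ x² - 1 ≤ 12 / P.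
  rw [abs_le]
  constructor <;> nlinarith

/-! ### The codebook, its multiplicities and its asymptotic optimality. -/

section Codebook

variable {p : ℕ} [Fact p.Prime] {s : ℕ} {e : Fin s → ℕ} {n m t : ℕ}
  {incl : ∀ j, GaloisField p t →+* GaloisField p (e j)}
  {incl' : GaloisField p t →+* GaloisField p m} {F : Space p e → GaloisField p m} {d l : ℤ}
  {υ : ℂ}

lemma ConditionII.norm_mainTerm (h : ConditionII p e n m t incl incl' F d l υ) {k : ℕ}
    (hk : n = m + 2 * k) :
    (‖mainTerm p n m υ - 1‖ = (p : ℝ) ^ k - 1 ∧ ‖mainTerm p n m υ + 1‖ = (p : ℝ) ^ k + 1) ∨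
      (‖mainTerm p n m υ - 1‖ = (p : ℝ) ^ k + 1 ∧ ‖mainTerm p n m υ + 1‖ = (p : ℝ) ^ k - 1) := by
  obtain ⟨σ, -, hσ, hmain, -⟩ := h.exists_distribution hk
  have hp : (1 : ℝ) ≤ p := by exact_mod_cast (Fact.out : p.Prime).one_le
  refine norm_sub_one_add_one_of_sign (one_le_pow₀ hp) hσ ?_
  rw [hmain]
  push_cast
  rfl

/-- The norms of the character sums over `D₁`, sorted by a `{0, 1, -1}`-valued function. -/
lemma norm_sum_D1 {g : Space p e → ℤ}
    (hS : ∀ b, b ≠ 0 → ∑ x ∈ D1 F, chi b x = mainTerm p n m υ * g b - 1)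
    {b : Space p e} (hb : b ≠ 0) :
    (g b = 0 → ‖∑ x ∈ D1 F, chi b x‖ = 1) ∧
      (g b = 1 → ‖∑ x ∈ D1 F, chi b x‖ = ‖mainTerm p n m υ - 1‖) ∧
      (g b = -1 → ‖∑ x ∈ D1 F, chi b x‖ = ‖mainTerm p n m υ + 1‖) := by
  rw [hS b hb]
  refine ⟨fun h0 => by simp [h0], fun h1 => by simp [h1], fun h1 => ?_⟩
  rw [h1, ← norm_neg]
  congr 1
  push_cast
  ring

lemma ConditionII.codebook_properties (h : ConditionII p e n m t incl incl' F d l υ) {k : ℕ}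
    (hk : n = m + 2 * k) (hmk : m ≤ k) {K : ℕ} (hK : K = p ^ (2 * k) - 1) :
    IsCodebook (codebook F) (p ^ n) K ∧ Function.Injective (codeword F) ∧
      IsGreatest (crossCorrSet (codebook F))
        (max (1 / (K : ℝ) * ‖mainTerm p n m υ - 1‖) (1 / (K : ℝ) * ‖mainTerm p n m υ + 1‖)) ∧
      (∀ b₁ b₂ : Space p e, b₁ ≠ b₂ → crossCorr (codeword F b₁) (codeword F b₂) ∈
        ({1 / (K : ℝ), 1 / (K : ℝ) * ‖mainTerm p n m υ - 1‖,
          1 / (K : ℝ) * ‖mainTerm p n m υ + 1‖} : Set ℝ)) ∧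
      (multiplicity F (1 / (K : ℝ)) : ℂ) = (p : ℂ) ^ n * ((p : ℂ) ^ (2 * k) - 1) ∧
      (multiplicity F (1 / (K : ℝ) * ‖mainTerm p n m υ - 1‖) : ℂ) =
        (p : ℂ) ^ n * ((((p : ℂ) ^ (2 * k) + mainTerm p n m υ) * ((p : ℂ) ^ m - 1)) / 2) ∧
      (multiplicity F (1 / (K : ℝ) * ‖mainTerm p n m υ + 1‖) : ℂ) =
        (p : ℂ) ^ n * ((((p : ℂ) ^ (2 * k) - mainTerm p n m υ) * ((p : ℂ) ^ m - 1)) / 2) := by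
  classical
  obtain ⟨σ, g, hσ, hmain, hg, hg0, hcard, hS, hfirst, hsecond⟩ := h.exists_distribution hk
  rw [← hK] at hcard
  have hq3 := h.three_le_pow hmk
  have hKr : (K : ℝ) = ((p : ℝ) ^ k) ^ 2 - 1 := by
    rw [hK, Nat.cast_sub (Nat.one_le_pow _ _ (Fact.out : p.Prime).pos), pow_mul']
    push_cast
    rfl
  have hKpos : (0 : ℝ) < K := by rw [hKr]; nlinarith
  have hcancel : ∀ x y : ℝ, 1 / (K : ℝ) * x = 1 / (K : ℝ) * y ↔ x = y := fun x y =>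
    mul_right_inj' (one_div_pos.mpr hKpos).ne'
  have hcancel' : ∀ x : ℝ, 1 / (K : ℝ) * x = 1 / (K : ℝ) ↔ x = 1 := fun x => by
    rw [← hcancel x 1, mul_one]
  have hnorm := h.norm_mainTerm hk
  have hmem : ∀ b₁ b₂ : Space p e, b₁ ≠ b₂ → crossCorr (codeword F b₁) (codeword F b₂) ∈
      ({1 / (K : ℝ), 1 / (K : ℝ) * ‖mainTerm p n m υ - 1‖,
        1 / (K : ℝ) * ‖mainTerm p n m υ + 1‖} : Set ℝ) := by
    intro b₁ b₂ hne
    obtain ⟨h0, h1, h2⟩ := norm_sum_D1 hS (sub_ne_zero.mpr hne)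
    rw [crossCorr_codeword, hcard]
    simp only [Set.mem_insert_iff, Set.mem_singleton_iff, hcancel, hcancel']
    rcases hg (b₁ - b₂) with h3 | h3 | h3
    · exact Or.inl (h0 h3)
    · exact Or.inr (Or.inl (h1 h3))
    · exact Or.inr (Or.inr (h2 h3))
  have hself : ∀ b, crossCorr (codeword F b) (codeword F b) = 1 := by
    intro b
    rw [crossCorr_codeword, sub_self]
    simp only [chi_zero_left, Finset.sum_const, nsmul_eq_mul, mul_one, Complex.norm_natCast]
    rw [hcard, one_div_mul_cancel hKpos.ne']
  -- All amplitudes are at most (p^k + 1) / K = 1 / (p^k - 1) < 1, as p^k ≥ 3. Since a codeword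
  -- correlates with itself to 1, distinct b give distinct codewords.
  have hlt : ∀ b₁ b₂ : Space p e, b₁ ≠ b₂ →
      crossCorr (codeword F b₁) (codeword F b₂) < 1 := by
    intro b₁ b₂ hne
    have h1 : ∀ x : ℝ, x ≤ (p : ℝ) ^ k + 1 → 1 / (K : ℝ) * x < 1 := by
      intro x hx
      rw [one_div_mul_eq_div, div_lt_one hKpos, hKr]
      nlinarith
    rcases hmem b₁ b₂ hne with h2 | h2 | h2
    · rw [h2, ← mul_one (1 / (K : ℝ))]
      exact h1 1 (by linarith)
    · rw [h2]
      rcases hnorm with ⟨h3, -⟩ | ⟨h3, -⟩ <;> rw [h3] <;> exact h1 _ (by linarith)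
    · rw [h2]
      rcases hnorm with ⟨-, h3⟩ | ⟨-, h3⟩ <;> rw [h3] <;> exact h1 _ (by linarith)
  have hinj : Function.Injective (codeword F) := by
    intro b₁ b₂ heq
    by_contra hne
    have h1 := hlt b₁ b₂ hne
    rw [heq, hself] at h1
    exact lt_irrefl _ h1
  have hnorm_one : ∀ b, ‖codeword F b‖ = 1 := by
    intro b
    have h1 := hself b
    rw [crossCorr, inner_self_eq_norm_sq_to_K] at h1
    rw [norm_pow, RCLike.norm_ofReal, abs_norm] at h1
    exact (pow_eq_one_iff_of_nonneg (norm_nonneg _) (by norm_num)).mp h1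
  -- Both signs occur: the moments give p^k (p^k ± 1) (p^m - 1) / 2 solutions, which is positive.
  -- Hence the maximum is attained.
  have hqσ : ∀ τ : ℤ, (τ = 1 ∨ τ = -1) → ∃ b, g b = τ := by
    intro τ hτ
    by_contra hno
    push Not at hno
    have h1 := two_mul_card_filter_eq hg hτ
    rw [Finset.filter_false_of_mem (fun b _ => hno b), hfirst, hsecond] at h1
    have hpk : (3 : ℤ) ≤ (p : ℤ) ^ k := by exact_mod_cast hq3
    have hpm : (3 : ℤ) ≤ (p : ℤ) ^ m := by exact_mod_cast h.three_le_pow le_rfl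
    rw [pow_mul'] at h1
    simp only [Finset.card_empty, Nat.cast_zero, mul_zero] at h1
    have h2 : 0 < (p : ℤ) ^ k * ((p : ℤ) ^ m - 1) := by nlinarith
    rcases hτ with rfl | rfl <;> rcases hσ with rfl | rfl <;> nlinarith
  have hattain : ∀ τ : ℤ, (τ = 1 ∨ τ = -1) → ∃ b, b ≠ 0 ∧ g b = τ := by
    intro τ hτ
    obtain ⟨b, hb⟩ := hqσ τ hτ
    refine ⟨b, ?_, hb⟩
    rintro rfl
    rw [hg0] at hb
    rcases hτ with rfl | rfl <;> norm_num at hb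
  have hin : ∀ b : Space p e, b ≠ 0 →
      1 / (K : ℝ) * ‖∑ x ∈ D1 F, chi b x‖ ∈ crossCorrSet (codebook F) := by
    intro b hb
    refine ⟨_, ⟨b, rfl⟩, _, ⟨0, rfl⟩, hinj.ne hb, ?_⟩
    rw [crossCorr_codeword, sub_zero, hcard]
  have hgreatest : IsGreatest (crossCorrSet (codebook F))
      (max (1 / (K : ℝ) * ‖mainTerm p n m υ - 1‖)
        (1 / (K : ℝ) * ‖mainTerm p n m υ + 1‖)) := by
    constructor
    · rcases max_choice (1 / (K : ℝ) * ‖mainTerm p n m υ - 1‖)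
        (1 / (K : ℝ) * ‖mainTerm p n m υ + 1‖) with h1 | h1
      · obtain ⟨b, hb, hb1⟩ := hattain 1 (Or.inl rfl)
        rw [h1, ← (norm_sum_D1 hS hb).2.1 hb1]
        exact hin b hb
      · obtain ⟨b, hb, hb1⟩ := hattain (-1) (Or.inr rfl)
        rw [h1, ← (norm_sum_D1 hS hb).2.2 hb1]
        exact hin b hb
    · rintro r ⟨_, ⟨b₁, rfl⟩, _, ⟨b₂, rfl⟩, hne, rfl⟩
      rcases hmem b₁ b₂ (fun h1 => hne (by rw [h1])) with h1 | h1 | h1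
      · rw [h1, ← mul_max_of_nonneg _ _ (one_div_pos.mpr hKpos).le]
        refine le_mul_of_one_le_right (one_div_pos.mpr hKpos).le ?_
        rcases hnorm with ⟨-, h2⟩ | ⟨h2, -⟩
        · exact le_max_of_le_right (by rw [h2]; linarith)
        · exact le_max_of_le_left (by rw [h2]; linarith)
      · rw [h1]; exact le_max_left _ _
      · rw [h1]; exact le_max_right _ _
  have hcodebook : IsCodebook (codebook F) (p ^ n) K := by
    refine ⟨by rw [Fintype.card_coe, hcard], Set.finite_range _, ?_, ?_⟩
    · rw [codebook, ← Set.image_univ, Set.ncard_image_of_injective _ hinj, Set.ncard_univ,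
        Nat.card_eq_fintype_card, card_space h.e_pos, ← h.n_eq]
    · rintro _ ⟨b, rfl⟩
      exact hnorm_one b
  have hval : ∀ b : Space p e, b ≠ 0 →
      (‖∑ x ∈ D1 F, chi b x‖ = 1 ↔ g b = 0) ∧
      (‖∑ x ∈ D1 F, chi b x‖ = ‖mainTerm p n m υ - 1‖ ↔ g b = 1) ∧
      (‖∑ x ∈ D1 F, chi b x‖ = ‖mainTerm p n m υ + 1‖ ↔ g b = -1) := by
    intro b hb
    obtain ⟨h0, h1, h2⟩ := norm_sum_D1 hS hb
    -- The values 1, p^k - 1 and p^k + 1 are distinct because p^k ≥ 3, so the three multiplicities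
    -- do not merge.
    have hd : ‖mainTerm p n m υ - 1‖ ≠ 1 ∧ ‖mainTerm p n m υ + 1‖ ≠ 1 ∧
        ‖mainTerm p n m υ - 1‖ ≠ ‖mainTerm p n m υ + 1‖ := by
      rcases hnorm with ⟨h3, h4⟩ | ⟨h3, h4⟩ <;> rw [h3, h4] <;>
        refine ⟨fun h5 => ?_, fun h5 => ?_, fun h5 => ?_⟩ <;> linarith
    obtain ⟨hd1, hd2, hd3⟩ := hd
    rcases hg b with h3 | h3 | h3
    · simp [h3, h0 h3, hd1.symm, hd2.symm]
    · simp [h3, h1 h3, hd1, hd3]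
    · simp [h3, h2 h3, hd2, hd3.symm]
  have hhalf : ∀ τ : ℤ, (τ = 1 ∨ τ = -1) →
      ({b : Space p e | g b = τ}.ncard : ℂ) =
        (((p : ℂ) ^ (2 * k) + τ * mainTerm p n m υ) * ((p : ℂ) ^ m - 1)) / 2 := by
    intro τ hτ
    have h1 := two_mul_card_filter_eq hg hτ
    rw [hfirst, hsecond] at h1
    have h2 : (2 : ℂ) * ((Finset.univ.filter fun b => g b = τ).card : ℂ) =
        (p : ℂ) ^ (2 * k) * ((p : ℂ) ^ m - 1) +
          τ * (σ * (p : ℂ) ^ k * ((p : ℂ) ^ m - 1)) := by exact_mod_cast h1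
    rw [← Set.ncard_coe_finset, Finset.coe_filter] at h2
    simp only [Finset.mem_univ, true_and] at h2
    rw [hmain]
    linear_combination h2 / 2
  have hne0 : ∀ τ : ℤ, (τ = 1 ∨ τ = -1) → ∀ b, g b = τ → b ≠ 0 := by
    rintro τ hτ b hb rfl
    rw [hg0] at hb
    rcases hτ with rfl | rfl <;> norm_num at hb
  refine ⟨hcodebook, hinj, hgreatest, hmem, ?_, ?_, ?_⟩
  · rw [multiplicity_eq h.e_pos, ← h.n_eq, hcard]
    push_cast
    congr 1
    -- The point b = 0 also satisfies g b = 0 but corresponds to pairs b₁ = b₂; removing it leaves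
    -- p^{2k} - 1 differences.
    have h1 : {b : Space p e | b ≠ 0 ∧ 1 / (K : ℝ) * ‖∑ x ∈ D1 F, chi b x‖ = 1 / (K : ℝ)} =
        ((Finset.univ.filter fun b => g b = 0).erase 0 : Finset (Space p e)) := by
      ext b
      simp only [Set.mem_ofPred_eq, Finset.coe_erase, Finset.coe_filter, Finset.mem_univ,
        true_and, Set.mem_sdiff, Set.mem_singleton_iff, hcancel']
      constructor
      · rintro ⟨hb, h1⟩
        exact ⟨(hval b hb).1.mp h1, hb⟩
      · rintro ⟨h1, hb⟩
        exact ⟨hb, (hval b hb).1.mpr h1⟩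
    have h2 := card_filter_eq_zero hg
    have h3 := Finset.card_erase_add_one
      (show (0 : Space p e) ∈ Finset.univ.filter fun b => g b = 0 by simp [hg0])
    rw [← h3, hsecond, card_space h.e_pos, ← h.n_eq, hk, pow_add] at h2
    rw [h1, Set.ncard_coe_finset]
    have h4 : ((((Finset.univ.filter fun b => g b = 0).erase 0).card : ℂ) + 1) =
        (p : ℂ) ^ m * (p : ℂ) ^ (2 * k) - (p : ℂ) ^ (2 * k) * ((p : ℂ) ^ m - 1) := by
      exact_mod_cast h2
    linear_combination h4
  · have h1 : {b : Space p e | b ≠ 0 ∧ 1 / (K : ℝ) * ‖∑ x ∈ D1 F, chi b x‖ =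
        1 / (K : ℝ) * ‖mainTerm p n m υ - 1‖} = {b | g b = 1} := by
      ext b
      simp only [Set.mem_ofPred_eq, hcancel]
      constructor
      · rintro ⟨hb, h1⟩
        exact (hval b hb).2.1.mp h1
      · intro h1
        have hb := hne0 1 (Or.inl rfl) b h1
        exact ⟨hb, (hval b hb).2.1.mpr h1⟩
    rw [multiplicity_eq h.e_pos, ← h.n_eq, hcard, h1, Nat.cast_mul, hhalf 1 (Or.inl rfl)]
    push_cast
    ring
  · have h1 : {b : Space p e | b ≠ 0 ∧ 1 / (K : ℝ) * ‖∑ x ∈ D1 F, chi b x‖ =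
        1 / (K : ℝ) * ‖mainTerm p n m υ + 1‖} = {b | g b = -1} := by
      ext b
      simp only [Set.mem_ofPred_eq, hcancel]
      constructor
      · rintro ⟨hb, h1⟩
        exact (hval b hb).2.2.mp h1
      · intro h1
        have hb := hne0 (-1) (Or.inr rfl) b h1
        exact ⟨hb, (hval b hb).2.2.mpr h1⟩
    rw [multiplicity_eq h.e_pos, ← h.n_eq, hcard, h1, Nat.cast_mul, hhalf (-1) (Or.inr rfl)]
    push_cast
    ring

lemma ConditionII.abs_Imax_div_welchBound_sub_one_le
    (h : ConditionII p e n m t incl incl' F d l υ) :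
    |Imax (codebook F) / welchBound (p ^ n) (p ^ (n - m) - 1) - 1| ≤ 12 / (p : ℝ) ^ m := by
  obtain ⟨k, hk, hmk⟩ := h.exists_half
  have hnm : n - m = 2 * k := by omega
  have hI := (h.codebook_properties hk hmk rfl).2.2.1.csSup_eq
  have hp1 : (1 : ℝ) ≤ p := by exact_mod_cast (Fact.out : p.Prime).one_le
  have hKr : ((p ^ (2 * k) - 1 : ℕ) : ℝ) = ((p : ℝ) ^ k) ^ 2 - 1 := by
    rw [Nat.cast_sub (Nat.one_le_pow _ _ (Fact.out : p.Prime).pos), pow_mul']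
    push_cast
    rfl
  have hmax : max ‖mainTerm p n m υ - 1‖ ‖mainTerm p n m υ + 1‖ = (p : ℝ) ^ k + 1 := by
    rcases h.norm_mainTerm hk with ⟨h1, h2⟩ | ⟨h1, h2⟩ <;> rw [h1, h2]
    · exact max_eq_right (by linarith)
    · exact max_eq_left (by linarith)
  have hKpos : (0 : ℝ) ≤ 1 / ((p ^ (2 * k) - 1 : ℕ) : ℝ) := by positivity
  rw [← mul_max_of_nonneg _ _ hKpos, hmax] at hI
  rw [Imax, hI, welchBound, hnm, hKr]
  have hN : ((p ^ n : ℕ) : ℝ) = (p : ℝ) ^ m * ((p : ℝ) ^ k) ^ 2 := by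
    rw [hk, pow_add, pow_mul']
    push_cast
    rfl
  rw [hN]
  exact abs_div_sqrt_sub_one_le (h.three_le_pow le_rfl) (pow_le_pow_right₀ hp1 hmk)

end Codebook

end DualBent

theorem theorem7 :
    (∀ (p : ℕ) [Fact p.Prime] (s : ℕ) (e : Fin s → ℕ) (n m t : ℕ)
      (incl : ∀ j, GaloisField p t →+* GaloisField p (e j))
      (incl' : GaloisField p t →+* GaloisField p m)
      (F : DualBent.Space p e → GaloisField p m) (d l : ℤ) (υ : ℂ) (K : ℕ),
      DualBent.ConditionII p e n m t incl incl' F d l υ →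
      K = p ^ (n - m) - 1 →
      -- the parameters of the codebook; distinct `b` give distinct codewords
      DualBent.IsCodebook (DualBent.codebook F) (p ^ n) K ∧
      Function.Injective (DualBent.codeword F) ∧
      -- the maximal cross-correlation amplitude
      IsGreatest (DualBent.crossCorrSet (DualBent.codebook F))
        (DualBent.Imax (DualBent.codebook F)) ∧
      DualBent.Imax (DualBent.codebook F) =
        max (1 / (K : ℝ) * ‖DualBent.mainTerm p n m υ - 1‖)
          (1 / (K : ℝ) * ‖DualBent.mainTerm p n m υ + 1‖) ∧
      -- the value distribution
      (∀ b₁ b₂ : DualBent.Space p e, b₁ ≠ b₂ →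
        DualBent.crossCorr (DualBent.codeword F b₁) (DualBent.codeword F b₂) ∈
          ({1 / (K : ℝ), 1 / (K : ℝ) * ‖DualBent.mainTerm p n m υ - 1‖,
            1 / (K : ℝ) * ‖DualBent.mainTerm p n m υ + 1‖} : Set ℝ)) ∧
      (DualBent.multiplicity F (1 / (K : ℝ)) : ℂ) = (p : ℂ) ^ (2 * n - m) - (p : ℂ) ^ n ∧
      (DualBent.multiplicity F (1 / (K : ℝ) * ‖DualBent.mainTerm p n m υ - 1‖) : ℂ) =
        (p : ℂ) ^ n *
          ((((p : ℂ) ^ (n - m) + DualBent.freqTerm p n m υ) * ((p : ℂ) ^ m - 1)) / 2) ∧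
      (DualBent.multiplicity F (1 / (K : ℝ) * ‖DualBent.mainTerm p n m υ + 1‖) : ℂ) =
        (p : ℂ) ^ n *
          ((((p : ℂ) ^ (n - m) - DualBent.freqTerm p n m υ) * ((p : ℂ) ^ m - 1)) / 2)) ∧
    -- asymptotic optimality: `Imax / I_W` tends to `1` as `p` or `m` tends to infinity
    (∀ δ : ℝ, 0 < δ → ∃ M : ℕ,
      ∀ (p : ℕ) [Fact p.Prime] (s : ℕ) (e : Fin s → ℕ) (n m t : ℕ)
        (incl : ∀ j, GaloisField p t →+* GaloisField p (e j))
        (incl' : GaloisField p t →+* GaloisField p m)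
        (F : DualBent.Space p e → GaloisField p m) (d l : ℤ) (υ : ℂ),
        DualBent.ConditionII p e n m t incl incl' F d l υ →
        M ≤ p ∨ M ≤ m →
        |DualBent.Imax (DualBent.codebook F) /
          DualBent.welchBound (p ^ n) (p ^ (n - m) - 1) - 1| < δ) := by
  refine ⟨?_, ?_⟩
  · intro p _ s e n m t incl incl' F d l υ K h hK
    obtain ⟨k, hk, hmk⟩ := h.exists_half
    have hnm : n - m = 2 * k := by omega
    rw [hnm] at hK
    obtain ⟨h1, h2, h3, h4, h5, h6, h7⟩ := h.codebook_properties hk hmk hK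
    have hI : DualBent.Imax (DualBent.codebook F) = _ := h3.csSup_eq
    rw [hI, h.freqTerm_eq hk, hnm]
    refine ⟨h1, h2, h3, rfl, h4, ?_, h6, h7⟩
    rw [h5, show 2 * n - m = n + 2 * k by omega, pow_add]
    ring
  · intro δ hδ
    -- The error is at most 12 / p^m, and either M ≤ p or M ≤ m gives p^m ≥ M > 12 / δ.
    obtain ⟨M, hM⟩ := exists_nat_gt (12 / δ)
    refine ⟨M, ?_⟩
    intro p _ s e n m t incl incl' F d l υ h hpm
    refine h.abs_Imax_div_welchBound_sub_one_le.trans_lt ?_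
    have hMP : (M : ℝ) ≤ (p : ℝ) ^ m := by
      have h1 : M ≤ p ^ m := by
        rcases hpm with h2 | h2
        · exact h2.trans (Nat.le_self_pow h.m_pos.ne' p)
        · exact h2.trans (Nat.lt_pow_self (Fact.out : p.Prime).one_lt).le
      exact_mod_cast h1
    have hP : (0 : ℝ) < (p : ℝ) ^ m := by linarith [h.three_le_pow le_rfl]
    rw [div_lt_iff₀ hP]
    rw [div_lt_iff₀ hδ] at hM
    nlinarith
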